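/- **Setting.** Let $\sigma_1=|0\rangle\langle 1|+|1\rangle\langle 0|$ and $\sigma_3=|0\rangle\langle 0|-|1\rangle\langle 1|$. An operator is called real if all its entries in the standard basis are real. Let $\rho_{AB}$ be a real two-qubit density operator on $\mathbb{C}^2\otimes\mathbb{C}^2$. For $\theta\in\mathbb{R}$ let $|\theta\rangle=\cos\frac\theta2|0\rangle+\sin\frac\theta2|1\rangle$ and $$\tilde\rho_B(\theta)=\mathrm{Tr}_A\big[(|\theta\rangle\langle\theta|\otimes\mathbb{I}_B)\rho_{AB}\big].$$ The steering ellipse of $\rho_{AB}$ is $\{\tilde\rho_B(\theta)\mid\theta\in\mathbb{R}\}$, a subset of the three-dimensional real space of real Hermitian operators on $\mathbb{C}^2$ with the inner product $\mathrm{Tr}(X^\dagger Y)$. The tilt of $\lambda=\frac12(n\mathbb{I}+r_1\sigma_1+r_3\sigma_3)$ with $n,r_1,r_3\in\mathbb{R}$ is $\sqrt{r_1^2+r_3^2}/|n|$, and $\infty$ if $n=0$. The tilt of the steering ellipse is the tilt of any nonzero real Hermitian operator that is normal to its affine span if this span is two-dimensional, and $\infty$ otherwise. Let $\mathbb{RP}^1$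 be the set of real one-dimensional orthogonal projectors on $\mathbb{C}^2$. Write $|Z|=\sqrt{Z^\dagger Z}$, $|X|_Y=Y^{-1}|YXY|Y^{-1}$ for invertible Hermitian $Y$, $\langle X\rangle=X/\mathrm{Tr}(X)$ if $\mathrm{Tr}(X)\ne0$, and $\widehat P$ for the adjugate matrix of $P$. **Theorem.** Suppose that the steering ellipse of $\rho_{AB}$ has tilt less than $1$, and let $P\in\mathbb{RP}^1$. Then, for every positive definite density operator $Y$ on $\mathbb{C}^2$, the integral $\int_0^{2\pi}\big|\frac{\mathrm{d}}{\mathrm{d}\theta}\tilde\rho_B(\theta)\big|_Y\,\mathrm{d}\theta$ exists and has nonzero trace, and $$\lim_{Y\to P}\left\langle\int_0^{2\pi}\left|\frac{\mathrm{d}}{\mathrm{d}\theta}\tilde\rho_B(\theta)\right|_Y\mathrm{d}\theta\right\rangle=\widehat P=\mathbb{I}-P,$$ where the limit is taken over all positive definite density operators $Y$ on $\mathbb{C}^2$. -/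

import Mathlib

namespace Steering

noncomputable section

open scoped MatrixOrder ComplexOrder Kronecker ENNReal

/-- Operators on a single qubit `ℂ²`, in the standard basis `|0⟩, |1⟩`. -/
abbrev Op : Type := Matrix (Fin 2) (Fin 2) ℂ

/-- Operators on the two-qubit space `ℂ² ⊗ ℂ²`; the first index is Alice's, the second Bob's. -/
abbrev Op₂ : Type := Matrix (Fin 2 × Fin 2) (Fin 2 × Fin 2) ℂ

/-- A real operator: all entries in the standard basis are real. -/
def IsRealOp {ι : Type*} (X : Matrix ι ι ℂ) : Prop := ∀ i j, (X i j).im = 0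

/-- Density operators: positive semidefinite of trace one. -/
def density (ι : Type*) [Fintype ι] : Set (Matrix ι ι ℂ) :=
  {X | X.PosSemidef ∧ X.trace = 1}

/-- Positive definite density operators. -/
def posDefDensity (ι : Type*) [Fintype ι] : Set (Matrix ι ι ℂ) :=
  {X | X.PosDef ∧ X.trace = 1}

/-- Real density operators. -/
def realDensity (ι : Type*) [Fintype ι] : Set (Matrix ι ι ℂ) :=
  {X | X ∈ density ι ∧ IsRealOp X}

/-- Real one-dimensional orthogonal projectors on `ℂ²`. -/
def RP1 : Set Op := {P | IsStarProjection P ∧ P.rank = 1 ∧ IsRealOp P}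

/-- The Pauli operator `σ₁ = |0⟩⟨1| + |1⟩⟨0|`. -/
def σ₁ : Op := !![0, 1; 1, 0]

/-- The Pauli operator `σ₃ = |0⟩⟨0| - |1⟩⟨1|`. -/
def σ₃ : Op := !![1, 0; 0, -1]

/-- The tilt of a real Hermitian `N = (n I + r₁ σ₁ + r₃ σ₃) / 2`, that is `√(r₁² + r₃²) / |n|`,
and `∞` if `n = 0`; here `n = Tr N`, `r₁ = Tr (N σ₁)` and `r₃ = Tr (N σ₃)`. -/
def tilt (N : Op) : ℝ≥0∞ :=
  if N.trace.re = 0 then ⊤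
  else ENNReal.ofReal
    (√((N * σ₁).trace.re ^ 2 + (N * σ₃).trace.re ^ 2) / |N.trace.re|)

/-- The vector `|θ⟩ = cos (θ/2) |0⟩ + sin (θ/2) |1⟩`. -/
def ket (θ : ℝ) : Fin 2 → ℂ := ![(Real.cos (θ / 2) : ℂ), (Real.sin (θ / 2) : ℂ)]

/-- The projector `|θ⟩⟨θ|`. -/
def proj (θ : ℝ) : Op := Matrix.vecMulVec (ket θ) (star (ket θ))

/-- Partial trace over Alice's qubit. -/
def traceA (M : Op₂) : Op := Matrix.of fun b b' => ∑ a, M (a, b) (a, b')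

/-- Bob's subnormalized state `Tr_A ((|θ⟩⟨θ| ⊗ I) ρ)`. -/
def steered (ρ : Op₂) (θ : ℝ) : Op := traceA ((proj θ ⊗ₖ (1 : Op)) * ρ)

/-- The derivative `dρ̃_B/dθ`, taken entry by entry. -/
def steeredDeriv (ρ : Op₂) (θ : ℝ) : Op :=
  Matrix.of fun i j => deriv (fun t => steered ρ t i j) θ

/-- The steering ellipse of `ρ`, as a subset of the space of operators. -/
def ellipse (ρ : Op₂) : Set Op := Set.range (steered ρ)

/-- Nonzero real Hermitian operators that are normal, for the inner product
`⟨X, Y⟩ = Tr (X† Y)`, to the affine span of `S`. -/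
def normals (S : Set Op) : Set Op :=
  {N | N ≠ 0 ∧ N.IsHermitian ∧ IsRealOp N ∧
    ∀ v ∈ (affineSpan ℝ S).direction, (N.conjTranspose * v).trace = 0}

open scoped Classical in
/-- The tilt of the steering ellipse of `ρ`: the tilt of any nonzero normal to its affine span if
that span is two-dimensional, and `∞` otherwise. The real Hermitian operators form a real space
of dimension three, so in the first case the normals are the nonzero multiples of one operator;
they all have the same tilt, and the infimum is that common value. -/
def steeringTilt (ρ : Op₂) : ℝ≥0∞ :=
  if Module.finrank ℝ (affineSpan ℝ (ellipse ρ)).direction = 2 then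
    ⨅ N ∈ normals (ellipse ρ), tilt N
  else ⊤

/-- `|X|_Y = Y⁻¹ |Y X Y| Y⁻¹`, where `|Z| = √(Z† Z)`. -/
def absRel (Y X : Op) : Op := Y⁻¹ * CFC.abs (Y * X * Y) * Y⁻¹

/-- The operator `∫₀^{2π} |dρ̃_B/dθ|_Y dθ`; the integral is taken entry by entry. -/
def steeringOperator (ρ : Op₂) (Y : Op) : Op :=
  Matrix.of fun i j => ∫ θ in (0 : ℝ)..(2 * Real.pi), absRel Y (steeredDeriv ρ θ) i j

/-- The normalization `⟨X⟩ = X / Tr X`. -/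
def normalized (X : Op) : Op := (X.trace)⁻¹ • X

end

end Steering

/-! When `X` is indefinite, the Cayley–Hamilton theorem for `Y X Y` and for `|Y X Y|` writes
`|X|_Y` as a combination of `X` and `Ŷ²`, with a coefficient of `X` in `[-1, 1]` and the
coefficient `-2 det X / γ` of `Ŷ²`, where `γ` is the difference of the eigenvalues of `Y X Y`. Tilt
less than one makes every normal of the steering ellipse definite, hence every tangent operator
`X(θ) = dρ̃_B/dθ` indefinite. As `Y → P`, the gap `γ` tends to `|Tr (P X(θ) P)|`, a sinusoid in
`θ`, which has a zero; as `1/|θ - c|` is not integrable, Fatou's lemma makes the integral of the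
second coefficient diverge while the first term stays bounded. Normalization therefore leaves
`P̂² = P̂`. -/

namespace Steering

open scoped MatrixOrder ComplexOrder Kronecker ENNReal
open Matrix Filter Topology MeasureTheory

section CayleyHamilton

variable {R : Type*} [CommRing R] (A : Matrix (Fin 2) (Fin 2) R)

lemma adjugate_fin_two_eq_trace_smul_one_sub : A.adjugate = A.trace • 1 - A := by
  ext i j
  fin_cases i <;> fin_cases j <;> simp [adjugate_fin_two, trace_fin_two]

lemma mul_self_fin_two : A * A = A.trace • A - A.det • 1 := by
  rw [← mul_adjugate, adjugate_fin_two_eq_trace_smul_one_sub, mul_sub, mul_smul_one, sub_sub_cancel]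

lemma trace_mul_self_fin_two : (A * A).trace = A.trace ^ 2 - 2 * A.det := by
  rw [mul_self_fin_two, trace_sub, trace_smul, trace_smul, trace_one]
  simp only [smul_eq_mul, Fintype.card_fin, Nat.cast_ofNat]
  ring

lemma trace_adjugate_fin_two : A.adjugate.trace = A.trace := by
  simp [adjugate_fin_two, trace_fin_two, add_comm]

end CayleyHamilton

section Hermitian

variable {n : Type*} [Fintype n]

lemma ofReal_re_trace {A : Matrix n n ℂ} (hA : A.IsHermitian) : (A.trace.re : ℂ) = A.trace :=
  Complex.conj_eq_iff_re.1 <| by rw [← Complex.star_def, ← trace_conjTranspose, hA.eq]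

lemma isHermitian_mul_mul_self {Y X : Matrix n n ℂ} (hY : Y.IsHermitian) (hX : X.IsHermitian) :
    (Y * X * Y).IsHermitian := by
  simpa only [hY.eq] using isHermitian_mul_mul_conjTranspose Y hX

variable [DecidableEq n]

lemma ofReal_re_det {A : Matrix n n ℂ} (hA : A.IsHermitian) : (A.det.re : ℂ) = A.det :=
  Complex.conj_eq_iff_re.1 <| by rw [← Complex.star_def, ← det_conjTranspose, hA.eq]

lemma det_abs (Z : Matrix n n ℂ) : (CFC.abs Z).det = ‖Z.det‖ := by
  have hpos : 0 ≤ (CFC.abs Z).det := (nonneg_iff_posSemidef.1 (CFC.abs_nonneg Z)).det_nonneg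
  have hsq : ‖(CFC.abs Z).det‖ ^ 2 = ‖Z.det‖ ^ 2 := by
    rw [pow_two, ← norm_mul, ← det_mul, CFC.abs_mul_abs, det_mul, norm_mul, star_eq_conjTranspose,
      det_conjTranspose, norm_star, pow_two]
  rw [← (sq_eq_sq₀ (norm_nonneg _) (norm_nonneg _)).1 hsq, Complex.norm_of_nonneg' hpos]

lemma det_abs_of_det_neg {Z : Matrix n n ℂ} (hZ : Z.IsHermitian) (hdet : Z.det.re < 0) :
    (CFC.abs Z).det = -Z.det := by
  rw [det_abs, ← ofReal_re_det hZ, Complex.norm_real, Real.norm_of_nonpos hdet.le,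
    Complex.ofReal_neg]

lemma posDef_abs {Z : Matrix n n ℂ} (hZ : Z.det ≠ 0) : (CFC.abs Z).PosDef := by
  rw [(nonneg_iff_posSemidef.1 (CFC.abs_nonneg Z)).posDef_iff_det_ne_zero, det_abs]
  exact_mod_cast norm_ne_zero_iff.2 hZ

end Hermitian

section AbsoluteValue

/-- The difference of the two eigenvalues of a Hermitian operator on a qubit, as the square root
of the discriminant of its characteristic polynomial. -/
noncomputable def spectralGap (Z : Op) : ℝ := √Z.discr.re

lemma spectralGap_nonneg (Z : Op) : 0 ≤ spectralGap Z := Real.sqrt_nonneg _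

lemma spectralGap_of_isHermitian {Z : Op} (hZ : Z.IsHermitian) :
    spectralGap Z = √(Z.trace.re ^ 2 - 4 * Z.det.re) := by
  rw [spectralGap, discr_fin_two, ← ofReal_re_trace hZ, ← ofReal_re_det hZ]
  norm_cast

lemma spectralGap_of_det_eq_zero {Z : Op} (hZ : Z.IsHermitian) (hdet : Z.det = 0) :
    spectralGap Z = |Z.trace.re| := by
  simp [spectralGap_of_isHermitian hZ, hdet, Real.sqrt_sq_eq_abs]

lemma spectralGap_pos {Z : Op} (hZ : Z.IsHermitian) (hdet : Z.det.re < 0) : 0 < spectralGap Z := by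
  rw [spectralGap_of_isHermitian hZ]
  exact Real.sqrt_pos.2 (by nlinarith [sq_nonneg Z.trace.re])

lemma abs_trace_re_le_spectralGap {Z : Op} (hZ : Z.IsHermitian) (hdet : Z.det.re ≤ 0) :
    |Z.trace.re| ≤ spectralGap Z := by
  rw [spectralGap_of_isHermitian hZ]
  exact Real.abs_le_sqrt (by linarith)

@[fun_prop]
lemma continuous_spectralGap : Continuous spectralGap := by
  unfold spectralGap
  simp only [discr_fin_two]
  fun_prop

lemma trace_abs_of_det_neg {Z : Op} (hZ : Z.IsHermitian) (hdet : Z.det.re < 0) :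
    (CFC.abs Z).trace = spectralGap Z := by
  have hdiscr : (CFC.abs Z).trace ^ 2 = Z.discr := by
    have h := congrArg trace (CFC.abs_mul_abs Z)
    rw [star_eq_conjTranspose, hZ.eq, trace_mul_self_fin_two, trace_mul_self_fin_two,
      det_abs_of_det_neg hZ hdet] at h
    rw [discr_fin_two]
    linear_combination h
  obtain ⟨t, ht, htr⟩ := RCLike.nonneg_iff_exists_ofReal.1
    (nonneg_iff_posSemidef.1 (CFC.abs_nonneg Z)).trace_nonneg
  simp only [spectralGap, ← hdiscr, ← htr, Complex.coe_algebraMap, ← Complex.ofReal_pow,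
    Complex.ofReal_re, Real.sqrt_sq ht]

/- Both `|Z|` and `Z` have the same square and opposite determinants, so subtracting their
Cayley–Hamilton identities leaves a linear equation for `|Z|`. -/
lemma spectralGap_smul_abs {Z : Op} (hZ : Z.IsHermitian) (hdet : Z.det.re < 0) :
    spectralGap Z • CFC.abs Z = Z.trace • Z - (2 * Z.det) • (1 : Op) := by
  have h := CFC.abs_mul_abs Z
  rw [star_eq_conjTranspose, hZ.eq, mul_self_fin_two, mul_self_fin_two Z,
    det_abs_of_det_neg hZ hdet, trace_abs_of_det_neg hZ hdet, neg_smul, sub_neg_eq_add,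
    Complex.coe_smul] at h
  rw [two_mul, add_smul, ← sub_sub, ← h, add_sub_cancel_right]

end AbsoluteValue

section RelativeAbsoluteValue

lemma absRel_posDef {Y X : Op} (hY : Y.IsHermitian) (hYu : IsUnit Y) (hX : X.det ≠ 0) :
    (absRel Y X).PosDef := by
  have hYdet : Y.det ≠ 0 := ((isUnit_iff_isUnit_det Y).1 hYu).ne_zero
  have hZ : (Y * X * Y).det ≠ 0 := by
    simpa only [det_mul] using mul_ne_zero (mul_ne_zero hYdet hX) hYdet
  have hinj : Function.Injective (Y⁻¹).vecMul :=
    vecMul_injective_of_isUnit (isUnit_nonsing_inv_iff.2 hYu)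
  simpa only [absRel, hY.inv.eq] using (posDef_abs hZ).mul_mul_conjTranspose_same hinj

lemma det_re_mul_mul_self {Y X : Op} (hY : Y.IsHermitian) (hX : X.IsHermitian) :
    (Y * X * Y).det.re = Y.det.re ^ 2 * X.det.re := by
  rw [det_mul, det_mul, ← ofReal_re_det hY, ← ofReal_re_det hX]
  norm_cast
  ring

lemma det_re_mul_mul_self_neg {Y X : Op} (hY : Y.IsHermitian) (hYu : IsUnit Y)
    (hX : X.IsHermitian) (hdet : X.det.re < 0) : (Y * X * Y).det.re < 0 := by
  have hYdet : Y.det.re ≠ 0 := fun h =>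
    ((isUnit_iff_isUnit_det Y).1 hYu).ne_zero (by rw [← ofReal_re_det hY, h, Complex.ofReal_zero])
  rw [det_re_mul_mul_self hY hX]
  exact mul_neg_of_pos_of_neg (by positivity) hdet

lemma spectralGap_mul_mul_self_pos {Y X : Op} (hY : Y.IsHermitian) (hYu : IsUnit Y)
    (hX : X.IsHermitian) (hdet : X.det.re < 0) : 0 < spectralGap (Y * X * Y) :=
  spectralGap_pos (isHermitian_mul_mul_self hY hX) (det_re_mul_mul_self_neg hY hYu hX hdet)

/-- The coefficient of `X` when `|X|_Y` is written as a combination of `X` and `Ŷ²`, for an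
indefinite `X`. -/
noncomputable def absRelCoeffSelf (Y X : Op) : ℝ :=
  (Y * X * Y).trace.re / spectralGap (Y * X * Y)

/-- The coefficient of `Ŷ²` when `|X|_Y` is written as a combination of `X` and `Ŷ²`, for an
indefinite `X`. It blows up as `Y` degenerates to a projector `P` with `P X P = 0`. -/
noncomputable def absRelCoeffAdjugate (Y X : Op) : ℝ :=
  -2 * X.det.re / spectralGap (Y * X * Y)

lemma absRel_eq {Y X : Op} (hY : Y.IsHermitian) (hYu : IsUnit Y) (hX : X.IsHermitian)
    (hdet : X.det.re < 0) :
    absRel Y X = absRelCoeffSelf Y X • X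
      + absRelCoeffAdjugate Y X • (Y.adjugate * Y.adjugate) := by
  have hYdet : IsUnit Y.det := (isUnit_iff_isUnit_det Y).1 hYu
  have hZ := isHermitian_mul_mul_self hY hX
  have hgap := spectralGap_mul_mul_self_pos hY hYu hX hdet
  have hconj : Y⁻¹ * (Y * X * Y) * Y⁻¹ = X := by
    rw [Matrix.mul_assoc Y X Y, nonsing_inv_mul_cancel_left _ _ hYdet,
      mul_nonsing_inv_cancel_right _ _ hYdet]
  have hadj : Y.adjugate = Y.det • Y⁻¹ := by
    rw [inv_def, smul_smul, Ring.mul_inverse_cancel _ hYdet, one_smul]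
  have hsmul : spectralGap (Y * X * Y) • absRel Y X
      = (Y * X * Y).trace.re • X + (-2 * X.det.re) • (Y.adjugate * Y.adjugate) := by
    calc spectralGap (Y * X * Y) • absRel Y X
        = Y⁻¹ * (spectralGap (Y * X * Y) • CFC.abs (Y * X * Y)) * Y⁻¹ := by
          rw [absRel, mul_smul_comm, smul_mul_assoc]
      _ = (Y * X * Y).trace • X - (2 * (Y * X * Y).det) • (Y⁻¹ * Y⁻¹) := by
          rw [spectralGap_smul_abs hZ (det_re_mul_mul_self_neg hY hYu hX hdet), mul_sub, sub_mul,
            mul_smul_comm, smul_mul_assoc, hconj, mul_smul_comm, smul_mul_assoc, mul_one]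
      _ = (Y * X * Y).trace.re • X + (-2 * X.det.re) • (Y.adjugate * Y.adjugate) := by
          rw [← Complex.coe_smul, ← Complex.coe_smul, ofReal_re_trace hZ, hadj, smul_mul_assoc,
            mul_smul_comm, smul_smul, smul_smul, sub_eq_add_neg, ← neg_smul, det_mul, det_mul,
            Complex.ofReal_mul, ofReal_re_det hX]
          congr 2
          push_cast
          ring
  rw [absRelCoeffSelf, absRelCoeffAdjugate, div_eq_inv_mul, div_eq_inv_mul, mul_smul, mul_smul,
    ← smul_add, ← hsmul, inv_smul_smul₀ hgap.ne']

lemma abs_absRelCoeffSelf_le_one {Y X : Op} (hY : Y.IsHermitian) (hX : X.IsHermitian)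
    (hdet : X.det.re ≤ 0) : |absRelCoeffSelf Y X| ≤ 1 := by
  rw [absRelCoeffSelf, abs_div, abs_of_nonneg (spectralGap_nonneg _)]
  refine div_le_one_of_le₀ (abs_trace_re_le_spectralGap (isHermitian_mul_mul_self hY hX) ?_)
    (spectralGap_nonneg _)
  rw [det_re_mul_mul_self hY hX]
  exact mul_nonpos_of_nonneg_of_nonpos (sq_nonneg _) hdet

lemma absRelCoeffAdjugate_nonneg {Y X : Op} (hdet : X.det.re ≤ 0) : 0 ≤ absRelCoeffAdjugate Y X :=
  div_nonneg (by linarith) (spectralGap_nonneg _)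

end RelativeAbsoluteValue

section Indefinite

lemma posDef_of_trace_pos_of_det_pos {A : Op} (hA : A.IsHermitian) (htr : 0 < A.trace.re)
    (hdet : 0 < A.det.re) : A.PosDef := by
  have htr' : A.trace.re = hA.eigenvalues 0 + hA.eigenvalues 1 := by
    simp [hA.trace_eq_sum_eigenvalues, Fin.sum_univ_two]
  have hdet' : A.det.re = hA.eigenvalues 0 * hA.eigenvalues 1 := by
    simp [hA.det_eq_prod_eigenvalues, Fin.prod_univ_two]
  rw [hA.posDef_iff_eigenvalues_pos, Fin.forall_fin_two]
  rw [htr'] at htr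
  rw [hdet'] at hdet
  rcases pos_and_pos_or_neg_and_neg_of_mul_pos hdet with h | h
  · exact h
  · linarith

lemma det_neg_of_trace_eq_zero {Z : Op} (hZ : Z.IsHermitian) (htr : Z.trace = 0) (h0 : Z ≠ 0) :
    Z.det.re < 0 := by
  have hpos : 0 < (Zᴴ * Z).trace :=
    (posSemidef_conjTranspose_mul_self Z).trace_nonneg.lt_of_ne'
      (mt trace_conjTranspose_mul_self_eq_zero_iff.1 h0)
  rw [hZ.eq, trace_mul_self_fin_two, htr, ← ofReal_re_det hZ] at hpos
  have hpos' : (0 : ℝ) < 0 ^ 2 - 2 * Z.det.re := by exact_mod_cast hpos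
  linarith

lemma det_neg_of_trace_mul_eq_zero {N X : Op} (hN : N.PosDef) (hX : X.IsHermitian) (h0 : X ≠ 0)
    (htr : (N * X).trace = 0) : X.det.re < 0 := by
  obtain ⟨S, hS, rfl⟩ : ∃ S : Op, S.PosDef ∧ N = S * S :=
    ⟨CFC.sqrt N, hN.isStrictlyPositive.sqrt.posDef,
      (CFC.sqrt_mul_sqrt_self N hN.posSemidef.nonneg).symm⟩
  have htr' : (S * X * S).trace = 0 := by rw [trace_mul_cycle, htr]
  have hne : S * X * S ≠ 0 := by
    rwa [ne_eq, hS.isUnit.mul_left_eq_zero, hS.isUnit.mul_right_eq_zero]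
  have hdet := det_neg_of_trace_eq_zero (isHermitian_mul_mul_self hS.isHermitian hX) htr' hne
  rw [det_re_mul_mul_self hS.isHermitian hX] at hdet
  exact neg_of_mul_neg_right hdet (sq_nonneg _)

lemma trace_mul_pauli_sq_add_sq {N : Op} (hN : N.IsHermitian) (hreal : IsRealOp N) :
    (N * σ₁).trace.re ^ 2 + (N * σ₃).trace.re ^ 2 = N.trace.re ^ 2 - 4 * N.det.re := by
  have hsymm : N 1 0 = N 0 1 := by
    rw [← hN.apply 1 0, Complex.star_def, Complex.conj_eq_iff_im.2 (hreal 0 1)]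
  simp only [trace_fin_two, det_fin_two, σ₁, σ₃, mul_apply, of_apply, cons_val', cons_val_zero,
    cons_val_one, cons_val_fin_one, Fin.sum_univ_two, mul_zero, mul_one, zero_add, add_zero,
    mul_neg, sub_zero, hsymm, Complex.add_re, Complex.neg_re, Complex.sub_re, Complex.mul_re,
    hreal _ _]
  ring

lemma posDef_or_neg_posDef_of_tilt_lt_one {N : Op} (hN : N.IsHermitian) (hreal : IsRealOp N)
    (htilt : tilt N < 1) : N.PosDef ∨ (-N).PosDef := by
  rw [tilt] at htilt
  split_ifs at htilt with htr
  · simp at htilt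
  rw [ENNReal.ofReal_lt_one, div_lt_one (abs_pos.2 htr), Real.sqrt_lt' (abs_pos.2 htr), sq_abs,
    trace_mul_pauli_sq_add_sq hN hreal] at htilt
  have hdet : 0 < N.det.re := by linarith
  rcases lt_or_gt_of_ne htr with h | h
  · refine .inr (posDef_of_trace_pos_of_det_pos hN.neg ?_ ?_)
    · simpa using h
    · simpa [det_neg] using hdet
  · exact .inl (posDef_of_trace_pos_of_det_pos hN h hdet)

lemma det_neg_of_trace_mul_eq_zero_of_tilt_lt_one {N X : Op} (hN : N.IsHermitian)
    (hreal : IsRealOp N) (htilt : tilt N < 1) (hX : X.IsHermitian) (h0 : X ≠ 0)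
    (htr : (N * X).trace = 0) : X.det.re < 0 := by
  rcases posDef_or_neg_posDef_of_tilt_lt_one hN hreal htilt with h | h
  · exact det_neg_of_trace_mul_eq_zero h hX h0 htr
  · exact det_neg_of_trace_mul_eq_zero h hX h0 (by rw [neg_mul, trace_neg, htr, neg_zero])

lemma steeringTilt_lt_one_iff {ρ : Op₂} :
    steeringTilt ρ < 1 ↔ Module.finrank ℝ (affineSpan ℝ (ellipse ρ)).direction = 2 ∧
      ∃ N ∈ normals (ellipse ρ), tilt N < 1 := by
  rw [steeringTilt]
  split_ifs with h <;> simp [h, iInf_lt_iff]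

end Indefinite

section SteeringEllipse

/-- The operator `Tr_A ((M ⊗ I) ρ)` that an effect `M` of Alice prepares for Bob, extended
linearly to all operators `M`. -/
def conditionalOp (ρ : Op₂) : Op →ₗ[ℝ] Op where
  toFun M := traceA ((M ⊗ₖ (1 : Op)) * ρ)
  map_add' M N := by
    ext
    simp [traceA, add_kronecker, add_mul, Finset.sum_add_distrib]
  map_smul' r M := by
    ext
    simp [traceA, smul_kronecker]

lemma conditionalOp_apply (ρ : Op₂) (M : Op) (b b' : Fin 2) :
    conditionalOp ρ M b b' = ∑ a, ∑ a', M a a' * ρ (a', b) (a, b') := by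
  simp [conditionalOp, traceA, mul_apply, Fintype.sum_prod_type, one_apply]

lemma isHermitian_conditionalOp {ρ : Op₂} {M : Op} (hρ : ρ.IsHermitian) (hM : M.IsHermitian) :
    (conditionalOp ρ M).IsHermitian := by
  ext b b'
  simp only [conjTranspose_apply, conditionalOp_apply, star_sum, star_mul', hM.apply, hρ.apply]
  exact Finset.sum_comm

lemma isHermitian_σ₁ : σ₁.IsHermitian := by
  ext i j
  fin_cases i <;> fin_cases j <;> simp [σ₁]

lemma isHermitian_σ₃ : σ₃.IsHermitian := by
  ext i j
  fin_cases i <;> fin_cases j <;> simp [σ₃]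

lemma proj_eq (θ : ℝ) : proj θ = (1 / 2 : ℝ) • (1 + Real.cos θ • σ₃ + Real.sin θ • σ₁) := by
  obtain ⟨φ, rfl⟩ : ∃ φ, θ = 2 * φ := ⟨θ / 2, by ring⟩
  have hcos : Complex.cos φ ^ 2 = 1 - Complex.sin φ ^ 2 := Complex.cos_sq' φ
  ext i j
  fin_cases i <;> fin_cases j <;>
    simp [proj, ket, vecMulVec_apply, σ₁, σ₃, Complex.cos_two_mul, Complex.sin_two_mul,
      ← Complex.cos_conj, ← Complex.sin_conj, ← pow_two, hcos] <;>
    ring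

lemma steered_eq (ρ : Op₂) (θ : ℝ) :
    steered ρ θ = (1 / 2 : ℝ) • (conditionalOp ρ 1 + Real.cos θ • conditionalOp ρ σ₃
      + Real.sin θ • conditionalOp ρ σ₁) := by
  simp only [← map_smul, ← map_add, ← proj_eq]
  rfl

lemma steeredDeriv_eq (ρ : Op₂) (θ : ℝ) :
    steeredDeriv ρ θ = (1 / 2 : ℝ) • (Real.cos θ • conditionalOp ρ σ₁
      - Real.sin θ • conditionalOp ρ σ₃) := by
  ext i j
  have hcos := (Real.hasDerivAt_cos θ).smul_const (conditionalOp ρ σ₃ i j)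
  have hsin := (Real.hasDerivAt_sin θ).smul_const (conditionalOp ρ σ₁ i j)
  have h := ((hcos.const_add (conditionalOp ρ 1 i j)).add hsin).const_smul (1 / 2 : ℝ)
  simp only [steeredDeriv, of_apply, steered_eq, Matrix.smul_apply,
    Matrix.add_apply, Matrix.sub_apply]
  refine h.deriv.trans ?_
  rw [neg_smul, neg_add_eq_sub]

lemma continuous_steeredDeriv (ρ : Op₂) : Continuous (steeredDeriv ρ) := by
  rw [funext (steeredDeriv_eq ρ)]
  fun_prop

lemma isHermitian_steeredDeriv {ρ : Op₂} (hρ : ρ.IsHermitian) (θ : ℝ) :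
    (steeredDeriv ρ θ).IsHermitian := by
  have h₁ := isHermitian_conditionalOp hρ isHermitian_σ₁
  have h₃ := isHermitian_conditionalOp hρ isHermitian_σ₃
  rw [steeredDeriv_eq]
  exact ((h₁.smul (.all _)).sub (h₃.smul (.all _))).smul (.all _)

lemma steeredDeriv_add (ρ : Op₂) (θ φ : ℝ) :
    steeredDeriv ρ (θ + φ)
      = Real.cos φ • steeredDeriv ρ θ + Real.sin φ • steeredDeriv ρ (θ + Real.pi / 2) := by
  simp only [steeredDeriv_eq, Real.cos_add, Real.sin_add, Real.cos_pi_div_two,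
    Real.sin_pi_div_two]
  module

lemma steered_sub_steered (ρ : Op₂) (θ θ' : ℝ) :
    steered ρ θ - steered ρ θ'
      = (2 * Real.sin ((θ - θ') / 2)) • steeredDeriv ρ ((θ + θ') / 2) := by
  have hcos := Real.cos_sub_cos θ θ'
  have hsin := Real.sin_sub_sin θ θ'
  rw [steered_eq, steered_eq, steeredDeriv_eq, ← smul_sub, smul_comm (2 * _),
    add_sub_add_comm, add_sub_add_left_eq_sub, ← sub_smul, ← sub_smul, hcos, hsin]
  module

lemma steeredDeriv_mem_direction (ρ : Op₂) (θ : ℝ) :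
    steeredDeriv ρ θ ∈ (affineSpan ℝ (ellipse ρ)).direction := by
  have h : steered ρ (θ + Real.pi / 2) - steered ρ (θ - Real.pi / 2)
      ∈ (affineSpan ℝ (ellipse ρ)).direction :=
    AffineSubspace.vsub_mem_direction (mem_affineSpan ℝ ⟨_, rfl⟩) (mem_affineSpan ℝ ⟨_, rfl⟩)
  have hhalf : (θ + Real.pi / 2 - (θ - Real.pi / 2)) / 2 = Real.pi / 2 := by ring
  have hmid : (θ + Real.pi / 2 + (θ - Real.pi / 2)) / 2 = θ := by ring
  rw [steered_sub_steered, hhalf, hmid, Real.sin_pi_div_two, mul_one] at h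
  exact (Submodule.smul_mem_iff _ two_ne_zero).1 h

lemma direction_ellipse_le_span {ρ : Op₂} {θ : ℝ} (h : steeredDeriv ρ θ = 0) :
    (affineSpan ℝ (ellipse ρ)).direction ≤ ℝ ∙ steeredDeriv ρ (θ + Real.pi / 2) := by
  rw [direction_affineSpan, vectorSpan_def, Submodule.span_le]
  rintro _ ⟨_, ⟨φ, rfl⟩, _, ⟨φ', rfl⟩, rfl⟩
  refine Submodule.mem_span_singleton.2
    ⟨2 * Real.sin ((φ - φ') / 2) * Real.sin ((φ + φ') / 2 - θ), ?_⟩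
  have hrot := steeredDeriv_add ρ θ ((φ + φ') / 2 - θ)
  rw [h, smul_zero, zero_add, add_sub_cancel] at hrot
  simp only [vsub_eq_sub, steered_sub_steered, hrot, mul_smul]

lemma steeredDeriv_ne_zero {ρ : Op₂}
    (hdim : Module.finrank ℝ (affineSpan ℝ (ellipse ρ)).direction = 2) (θ : ℝ) :
    steeredDeriv ρ θ ≠ 0 := fun h => by
  have h₁ := Submodule.finrank_mono (direction_ellipse_le_span h)
  have h₂ : Module.finrank ℝ (ℝ ∙ steeredDeriv ρ (θ + Real.pi / 2)) ≤ 1 := by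
    simpa using finrank_span_le_card (R := ℝ) {steeredDeriv ρ (θ + Real.pi / 2)}
  omega

lemma det_steeredDeriv_neg {ρ : Op₂} (hρ : ρ.IsHermitian) (htilt : steeringTilt ρ < 1) (θ : ℝ) :
    (steeredDeriv ρ θ).det.re < 0 := by
  obtain ⟨hdim, N, ⟨-, hN, hreal, hnormal⟩, hNtilt⟩ := steeringTilt_lt_one_iff.1 htilt
  have htr := hnormal _ (steeredDeriv_mem_direction ρ θ)
  rw [hN.eq] at htr
  exact det_neg_of_trace_mul_eq_zero_of_tilt_lt_one hN hreal hNtilt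
    (isHermitian_steeredDeriv hρ θ) (steeredDeriv_ne_zero hdim θ) htr

end SteeringEllipse

section Sinusoid

lemma exists_sinusoid_eq_zero (a b : ℝ) :
    ∃ c ∈ Set.Icc 0 Real.pi, a * Real.cos c + b * Real.sin c = 0 := by
  have hcont : ContinuousOn (fun t => a * Real.cos t + b * Real.sin t) (Set.uIcc 0 Real.pi) := by
    fun_prop
  rw [← Set.uIcc_of_le Real.pi_pos.le]
  refine intermediate_value_uIcc hcont (Set.mem_uIcc.2 ?_)
  simpa using le_total a 0

lemma exists_abs_sinusoid_le (a b : ℝ) : ∃ c ∈ Set.Icc 0 Real.pi, ∃ K > 0,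
    ∀ θ, |a * Real.cos θ + b * Real.sin θ| ≤ K * |θ - c| := by
  obtain ⟨c, hc, h0⟩ := exists_sinusoid_eq_zero a b
  refine ⟨c, hc, |b * Real.cos c - a * Real.sin c| + 1, by positivity, fun θ => ?_⟩
  have hshift : a * Real.cos θ + b * Real.sin θ
      = (b * Real.cos c - a * Real.sin c) * Real.sin (θ - c) := by
    rw [← add_sub_cancel c θ, Real.cos_add, Real.sin_add, add_sub_cancel]
    linear_combination Real.cos (θ - c) * h0
  rw [hshift, abs_mul]
  exact mul_le_mul (lt_add_one _).le Real.abs_sin_le_abs (abs_nonneg _) (by positivity)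

lemma exists_abs_trace_mul_steeredDeriv_le (ρ : Op₂) (P : Op) :
    ∃ c ∈ Set.Icc 0 Real.pi, ∃ K > 0,
      ∀ θ, |(P * steeredDeriv ρ θ * P).trace.re| ≤ K * |θ - c| := by
  obtain ⟨c, hc, K, hK, h⟩ := exists_abs_sinusoid_le
    ((1 / 2) * (P * conditionalOp ρ σ₁ * P).trace.re)
    (-(1 / 2) * (P * conditionalOp ρ σ₃ * P).trace.re)
  refine ⟨c, hc, K, hK, fun θ => (congrArg abs ?_).trans_le (h θ)⟩
  simp only [steeredDeriv_eq, mul_smul_comm, smul_mul_assoc, mul_sub, sub_mul, trace_smul,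
    trace_sub, Complex.smul_re, Complex.sub_re, smul_eq_mul]
  ring

end Sinusoid

section Divergence

lemma tendsto_integral_atTop_of_lintegral_eq_top {α E : Type*} [MeasurableSpace E]
    {μ : Measure E} {l : Filter α} [l.IsCountablyGenerated] {f : α → E → ℝ} {g : E → ℝ≥0∞}
    (hmeas : ∀ y, AEStronglyMeasurable (f y) μ)
    (hnonneg : ∀ᶠ y in l, 0 ≤ᵐ[μ] f y) (hintegrable : ∀ᶠ y in l, Integrable (f y) μ)
    (hlim : ∀ᵐ x ∂μ, Tendsto (fun y => ENNReal.ofReal (f y x)) l (𝓝 (g x)))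
    (htop : ∫⁻ x, g x ∂μ = ∞) :
    Tendsto (fun y => ∫ x, f y x ∂μ) l atTop := by
  rcases l.eq_or_neBot with rfl | _
  · exact tendsto_bot
  have hfatou : l.liminf (fun y => ∫⁻ x, ENNReal.ofReal (f y x) ∂μ) = ∞ := by
    refine top_unique (htop.symm.trans_le ?_)
    calc ∫⁻ x, g x ∂μ
        = ∫⁻ x, l.liminf (fun y => ENNReal.ofReal (f y x)) ∂μ :=
          lintegral_congr_ae (hlim.mono fun x hx => hx.liminf_eq.symm)
      _ ≤ l.liminf (fun y => ∫⁻ x, ENNReal.ofReal (f y x) ∂μ) :=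
          lintegral_liminf_le' fun y => (hmeas y).aemeasurable.ennreal_ofReal
  rw [← ENNReal.tendsto_ofReal_nhds_top]
  refine Tendsto.congr' ?_ (tendsto_of_le_liminf_of_limsup_le hfatou.ge le_top)
  filter_upwards [hnonneg, hintegrable] with y hy hy'
  exact (ofReal_integral_eq_lintegral_ofReal hy' hy).symm

lemma lintegral_enorm_sub_inv_eq_top {a b c : ℝ} (hab : a < b) (hc : c ∈ Set.Icc a b) :
    ∫⁻ x in Set.Ioc a b, ‖(x - c)⁻¹‖ₑ = ∞ := by
  have hnot : ¬ IntervalIntegrable (fun x => (x - c)⁻¹) volume a b := by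
    simpa [intervalIntegrable_sub_inv_iff, hab.ne, Set.uIcc_of_le hab.le] using hc
  have hmeas : AEStronglyMeasurable (fun x : ℝ => (x - c)⁻¹) (volume.restrict (Set.Ioc a b)) :=
    (measurable_id.sub_const c).inv.aestronglyMeasurable
  rw [intervalIntegrable_iff_integrableOn_Ioc_of_le hab.le, IntegrableOn, Integrable,
    and_iff_right hmeas, HasFiniteIntegral, not_lt, top_le_iff] at hnot
  exact hnot

lemma lintegral_ofReal_div_ofReal_eq_top {a b c m K : ℝ} {u v : ℝ → ℝ} (hab : a < b)
    (hc : c ∈ Set.Icc a b) (hm : 0 < m) (hK : 0 < K) (hu : ∀ x ∈ Set.Ioc a b, m ≤ u x)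
    (hv : ∀ x ∈ Set.Ioc a b, v x ≤ K * |x - c|) :
    ∫⁻ x in Set.Ioc a b, ENNReal.ofReal (u x) / ENNReal.ofReal (v x) = ∞ := by
  refine top_unique ?_
  calc ∞ = ENNReal.ofReal (m / K) * ∫⁻ x in Set.Ioc a b, ‖(x - c)⁻¹‖ₑ := by
        rw [lintegral_enorm_sub_inv_eq_top hab hc, ENNReal.mul_top]
        exact (ENNReal.ofReal_pos.2 (div_pos hm hK)).ne'
    _ = ∫⁻ x in Set.Ioc a b, ENNReal.ofReal (m / K) * ‖(x - c)⁻¹‖ₑ :=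
        (lintegral_const_mul _ (measurable_id.sub_const c).inv.enorm).symm
    _ ≤ ∫⁻ x in Set.Ioc a b, ENNReal.ofReal (u x) / ENNReal.ofReal (v x) := by
        refine setLIntegral_mono' measurableSet_Ioc fun x hx => ?_
        rcases eq_or_ne x c with rfl | hxc
        · simp
        have habs : 0 < |x - c| := abs_pos.2 (sub_ne_zero.2 hxc)
        calc ENNReal.ofReal (m / K) * ‖(x - c)⁻¹‖ₑ
            = ENNReal.ofReal m / ENNReal.ofReal (K * |x - c|) := by
              rw [Real.enorm_eq_ofReal_abs, ← ENNReal.ofReal_mul (div_pos hm hK).le, abs_inv,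
                ← ENNReal.ofReal_div_of_pos (mul_pos hK habs), ← div_eq_mul_inv, div_div]
          _ ≤ ENNReal.ofReal (u x) / ENNReal.ofReal (v x) :=
              ENNReal.div_le_div (ENNReal.ofReal_le_ofReal (hu x hx))
                (ENNReal.ofReal_le_ofReal (hv x hx))

/- The quotient is taken in `ℝ≥0∞`, where the limit is right also if `P X P = 0`: it is `∞`. -/
lemma tendsto_ofReal_absRelCoeffAdjugate {P X : Op} (hX : X.IsHermitian) (hdet : X.det.re < 0) :
    Tendsto (fun Y => ENNReal.ofReal (absRelCoeffAdjugate Y X))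
      (𝓝[{Y | Y.IsHermitian ∧ IsUnit Y}] P)
      (𝓝 (ENNReal.ofReal (-2 * X.det.re) / ENNReal.ofReal (spectralGap (P * X * P)))) := by
  have hgap : Tendsto (fun Y : Op => ENNReal.ofReal (spectralGap (Y * X * Y)))
      (𝓝[{Y | Y.IsHermitian ∧ IsUnit Y}] P) (𝓝 (ENNReal.ofReal (spectralGap (P * X * P)))) := by
    have h : Continuous fun Y : Op => ENNReal.ofReal (spectralGap (Y * X * Y)) :=
      ENNReal.continuous_ofReal.comp (by fun_prop)
    exact h.continuousWithinAt
  have hnum : ENNReal.ofReal (-2 * X.det.re) ≠ 0 := (ENNReal.ofReal_pos.2 (by linarith)).ne'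
  refine Tendsto.congr' ?_ (ENNReal.Tendsto.div tendsto_const_nhds (.inl hnum) hgap
    (.inr ENNReal.ofReal_ne_top))
  filter_upwards [self_mem_nhdsWithin] with Y hY
  exact (ENNReal.ofReal_div_of_pos (spectralGap_mul_mul_self_pos hY.1 hY.2 hX hdet)).symm

end Divergence

section Normalization

lemma normalized_smul {r : ℂ} (hr : r ≠ 0) (X : Op) : normalized (r • X) = normalized X := by
  rw [normalized, normalized, trace_smul, smul_smul, smul_eq_mul, mul_inv, mul_right_comm,
    inv_mul_cancel₀ hr, one_mul]

lemma tendsto_normalized {α : Type*} {l : Filter α} {f : α → Op} {A : Op}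
    (hf : Tendsto f l (𝓝 A)) (hA : A.trace = 1) :
    Tendsto (fun y => normalized (f y)) l (𝓝 A) := by
  have htr : Tendsto (fun y => (f y).trace) l (𝓝 A.trace) :=
    (continuous_id.matrix_trace.tendsto A).comp hf
  simpa only [normalized, hA, inv_one, one_smul] using (htr.inv₀ (by simp [hA])).smul hf

open scoped Matrix.Norms.Elementwise in
lemma tendsto_normalized_add_smul {α : Type*} {l : Filter α} {R A : α → Op} {J : α → ℝ}
    {A₀ : Op} {C : ℝ} (hR : ∀ᶠ y in l, ‖R y‖ ≤ C) (hJ : Tendsto J l atTop)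
    (hA : Tendsto A l (𝓝 A₀)) (htr : A₀.trace = 1) :
    Tendsto (fun y => normalized (R y + J y • A y)) l (𝓝 A₀) := by
  have hsmall : Tendsto (fun y => (J y)⁻¹ • R y) l (𝓝 0) :=
    hJ.inv_tendsto_atTop.zero_smul_isBoundedUnder_le (isBoundedUnder_of_eventually_le hR)
  have hsum : Tendsto (fun y => (J y)⁻¹ • R y + A y) l (𝓝 A₀) := by
    simpa only [zero_add] using hsmall.add hA
  refine (tendsto_normalized hsum htr).congr' ?_
  filter_upwards [hJ.eventually_gt_atTop 0] with y hy
  rw [← normalized_smul (Complex.ofReal_ne_zero.2 hy.ne'), Complex.coe_smul, smul_add,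
    smul_inv_smul₀ hy.ne']

end Normalization

section Curve

open scoped Matrix.Norms.Elementwise

variable {X : ℝ → Op} (hXc : Continuous X) (hX : ∀ θ, (X θ).IsHermitian)
  (hdet : ∀ θ, (X θ).det.re < 0) {Y : Op} (hY : Y.IsHermitian) (hYu : IsUnit Y)

include hXc hX hdet hY hYu

lemma continuous_absRelCoeffSelf : Continuous fun θ => absRelCoeffSelf Y (X θ) := by
  unfold absRelCoeffSelf
  exact Continuous.div (by fun_prop) (by fun_prop) fun θ =>
    (spectralGap_mul_mul_self_pos hY hYu (hX θ) (hdet θ)).ne'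

lemma continuous_absRelCoeffAdjugate : Continuous fun θ => absRelCoeffAdjugate Y (X θ) := by
  unfold absRelCoeffAdjugate
  exact Continuous.div (by fun_prop) (by fun_prop) fun θ =>
    (spectralGap_mul_mul_self_pos hY hYu (hX θ) (hdet θ)).ne'

lemma continuous_absRel : Continuous fun θ => absRel Y (X θ) := by
  have h₁ := continuous_absRelCoeffSelf hXc hX hdet hY hYu
  have h₂ := continuous_absRelCoeffAdjugate hXc hX hdet hY hYu
  simp only [absRel_eq hY hYu (hX _) (hdet _)]
  fun_prop

lemma integral_absRel (a b : ℝ) :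
    ∫ θ in a..b, absRel Y (X θ) = (∫ θ in a..b, absRelCoeffSelf Y (X θ) • X θ)
      + (∫ θ in a..b, absRelCoeffAdjugate Y (X θ)) • (Y.adjugate * Y.adjugate) := by
  have h₁ := continuous_absRelCoeffSelf hXc hX hdet hY hYu
  have h₂ := continuous_absRelCoeffAdjugate hXc hX hdet hY hYu
  simp only [absRel_eq hY hYu (hX _) (hdet _)]
  rw [intervalIntegral.integral_add, intervalIntegral.integral_smul_const]
  · exact Continuous.intervalIntegrable (by fun_prop) _ _
  · exact Continuous.intervalIntegrable (by fun_prop) _ _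

lemma trace_integral_absRel_ne_zero {a b : ℝ} (hab : a < b) :
    (∫ θ in a..b, absRel Y (X θ)).trace ≠ 0 := by
  have hc := continuous_absRel hXc hX hdet hY hYu
  have hpos (θ : ℝ) : 0 < (absRel Y (X θ)).trace.re :=
    (Complex.pos_iff.1 (absRel_posDef hY hYu fun h => (hdet θ).ne (by simp [h])).trace_pos).1
  let reTrace : Op →L[ℝ] ℝ :=
    Complex.reCLM ∘L ((traceLinearMap (Fin 2) ℝ ℂ).toContinuousLinearMap)
  have hcomm : (∫ θ in a..b, absRel Y (X θ)).trace.re = ∫ θ in a..b, (absRel Y (X θ)).trace.re :=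
    (reTrace.intervalIntegral_comp_comm (hc.intervalIntegrable a b)).symm
  have hintegral : 0 < ∫ θ in a..b, (absRel Y (X θ)).trace.re :=
    intervalIntegral.intervalIntegral_pos_of_pos
      (Continuous.intervalIntegrable (by fun_prop) a b) hpos hab
  intro h
  rw [← hcomm, h, Complex.zero_re] at hintegral
  exact lt_irrefl _ hintegral

end Curve

section Projector

variable {𝕜 : Type*} [Field 𝕜] {P : Matrix (Fin 2) (Fin 2) 𝕜}

lemma det_eq_zero_of_rank_eq_one (hrank : P.rank = 1) : P.det = 0 := by
  by_contra h
  have := rank_of_isUnit P ((isUnit_iff_isUnit_det P).2 (isUnit_iff_ne_zero.2 h))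
  simp [hrank] at this

lemma trace_eq_one_of_isIdempotentElem (hP : IsIdempotentElem P) (hrank : P.rank = 1) :
    P.trace = 1 := by
  have hne : P ≠ 0 := by
    rintro rfl
    simp at hrank
  have h := mul_self_fin_two P
  rw [hP.eq, det_eq_zero_of_rank_eq_one hrank, zero_smul, sub_zero] at h
  have hsmul : (1 - P.trace) • P = 0 := by rw [sub_smul, one_smul, ← h, sub_self]
  exact (sub_eq_zero.1 ((smul_eq_zero.1 hsmul).resolve_right hne)).symm

lemma adjugate_eq_one_sub (hP : IsIdempotentElem P) (hrank : P.rank = 1) :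
    P.adjugate = 1 - P := by
  rw [adjugate_fin_two_eq_trace_smul_one_sub, trace_eq_one_of_isIdempotentElem hP hrank, one_smul]

lemma isIdempotentElem_adjugate {n R : Type*} [Fintype n] [DecidableEq n] [CommRing R]
    {A : Matrix n n R} (hA : IsIdempotentElem A) : IsIdempotentElem A.adjugate := by
  rw [IsIdempotentElem, ← adjugate_mul_distrib, hA.eq]

end Projector

section Limit

open scoped Matrix.Norms.Elementwise

lemma norm_integral_absRelCoeffSelf_smul_le {X : ℝ → Op} (hXc : Continuous X)
    (hX : ∀ θ, (X θ).IsHermitian) (hdet : ∀ θ, (X θ).det.re < 0) {Y : Op} (hY : Y.IsHermitian)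
    {a b : ℝ} (hab : a ≤ b) :
    ‖∫ θ in a..b, absRelCoeffSelf Y (X θ) • X θ‖ ≤ ∫ θ in a..b, ‖X θ‖ := by
  refine intervalIntegral.norm_integral_le_of_norm_le hab (ae_of_all _ fun θ _ => ?_)
    (hXc.norm.intervalIntegrable a b)
  rw [norm_smul, Real.norm_eq_abs]
  exact mul_le_of_le_one_left (norm_nonneg _)
    (abs_absRelCoeffSelf_le_one hY (hX θ) (hdet θ).le)

variable {X : ℝ → Op} (hXc : Continuous X) (hX : ∀ θ, (X θ).IsHermitian)
  (hdet : ∀ θ, (X θ).det.re < 0) {P : Op} {a b c K : ℝ} (hab : a < b) (hc : c ∈ Set.Icc a b)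
  (hK : 0 < K) (hbound : ∀ θ, |(P * X θ * P).trace.re| ≤ K * |θ - c|)

include hXc hX hdet hab hc hK hbound

lemma tendsto_integral_absRelCoeffAdjugate (hP : P.IsHermitian) (hPdet : P.det = 0) :
    Tendsto (fun Y => ∫ θ in a..b, absRelCoeffAdjugate Y (X θ))
      (𝓝[{Y | Y.IsHermitian ∧ IsUnit Y}] P) atTop := by
  have hdetc : Continuous fun θ => (X θ).det.re := by fun_prop
  obtain ⟨m, hm, hmdet⟩ := isCompact_Icc.exists_forall_le' (s := Set.Icc a b) (a := 0)
    (f := fun θ => -2 * (X θ).det.re) (by fun_prop) fun θ _ => by linarith [hdet θ]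
  have hgap (θ : ℝ) : spectralGap (P * X θ * P) ≤ K * |θ - c| := by
    rw [spectralGap_of_det_eq_zero (isHermitian_mul_mul_self hP (hX θ)) (by simp [hPdet])]
    exact hbound θ
  have : FirstCountableTopology Op := inferInstanceAs (FirstCountableTopology (Fin 2 → Fin 2 → ℂ))
  simp only [intervalIntegral.integral_of_le hab.le]
  refine tendsto_integral_atTop_of_lintegral_eq_top
    (g := fun θ => ENNReal.ofReal (-2 * (X θ).det.re) / ENNReal.ofReal (spectralGap (P * X θ * P)))
    (fun Y => ?_) (.of_forall fun Y => ae_of_all _ fun θ => absRelCoeffAdjugate_nonneg (hdet θ).le)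
    ?_ (ae_of_all _ fun θ => tendsto_ofReal_absRelCoeffAdjugate (hX θ) (hdet θ))
    (lintegral_ofReal_div_ofReal_eq_top hab hc hm hK
      (fun θ hθ => hmdet θ (Set.Ioc_subset_Icc_self hθ)) fun θ _ => hgap θ)
  · unfold absRelCoeffAdjugate
    have hgapc : Continuous fun θ => spectralGap (Y * X θ * Y) := by fun_prop
    exact ((hdetc.measurable.const_mul _).div hgapc.measurable).aestronglyMeasurable
  · filter_upwards [self_mem_nhdsWithin] with Y hY
    exact (continuous_absRelCoeffAdjugate hXc hX hdet hY.1 hY.2).integrableOn_Ioc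

lemma tendsto_normalized_integral_absRel (hP : IsStarProjection P) (hrank : P.rank = 1) :
    Tendsto (fun Y => normalized (∫ θ in a..b, absRel Y (X θ)))
      (𝓝[{Y | Y.IsHermitian ∧ IsUnit Y}] P) (𝓝 P.adjugate) := by
  have hJ := tendsto_integral_absRelCoeffAdjugate hXc hX hdet hab hc hK hbound
    hP.isSelfAdjoint.isHermitian (det_eq_zero_of_rank_eq_one hrank)
  have hadj : Tendsto (fun Y : Op => Y.adjugate * Y.adjugate)
      (𝓝[{Y | Y.IsHermitian ∧ IsUnit Y}] P) (𝓝 P.adjugate) := by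
    have h : Continuous fun Y : Op => Y.adjugate * Y.adjugate := by fun_prop
    simpa only [(isIdempotentElem_adjugate hP.isIdempotentElem).eq]
      using h.continuousWithinAt (s := {Y | Y.IsHermitian ∧ IsUnit Y}) (x := P) |>.tendsto
  have htr : P.adjugate.trace = 1 := by
    rw [trace_adjugate_fin_two, trace_eq_one_of_isIdempotentElem hP.isIdempotentElem hrank]
  refine (tendsto_normalized_add_smul (R := fun Y => ∫ θ in a..b, absRelCoeffSelf Y (X θ) • X θ)
    (C := ∫ θ in a..b, ‖X θ‖) ?_ hJ hadj htr).congr' ?_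
  · filter_upwards [self_mem_nhdsWithin] with Y hY
    exact norm_integral_absRelCoeffSelf_smul_le hXc hX hdet hY.1 hab.le
  · filter_upwards [self_mem_nhdsWithin] with Y hY
    rw [integral_absRel hXc hX hdet hY.1 hY.2]

end Limit

section SteeringOperator

open scoped Matrix.Norms.Elementwise

lemma steeringOperator_eq_integral {ρ : Op₂} (hρ : ρ.IsHermitian) (htilt : steeringTilt ρ < 1)
    {Y : Op} (hY : Y.IsHermitian) (hYu : IsUnit Y) :
    steeringOperator ρ Y = ∫ θ in (0 : ℝ)..(2 * Real.pi), absRel Y (steeredDeriv ρ θ) := by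
  have hc := continuous_absRel (continuous_steeredDeriv ρ) (isHermitian_steeredDeriv hρ)
    (det_steeredDeriv_neg hρ htilt) hY hYu
  ext i j
  exact (entryLinearMap ℝ ℂ i j).toContinuousLinearMap.intervalIntegral_comp_comm
    (hc.intervalIntegrable _ _)

end SteeringOperator

lemma posDefDensity_subset (n : Type*) [Fintype n] [DecidableEq n] :
    posDefDensity n ⊆ {Y | Y.IsHermitian ∧ IsUnit Y} :=
  fun _ hY => ⟨hY.1.isHermitian, hY.1.isUnit⟩

theorem theorem1_general {ρ : Op₂} (hρ : ρ.IsHermitian) (htilt : steeringTilt ρ < 1) {P : Op}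
    (hP : IsStarProjection P) (hrank : P.rank = 1) :
    (∀ Y : Op, Y.IsHermitian → IsUnit Y →
      (∀ i j, IntervalIntegrable (fun θ => absRel Y (steeredDeriv ρ θ) i j)
        volume 0 (2 * Real.pi)) ∧
      (steeringOperator ρ Y).trace ≠ 0) ∧
    Tendsto (fun Y => normalized (steeringOperator ρ Y))
      (𝓝[{Y | Y.IsHermitian ∧ IsUnit Y}] P) (𝓝 P.adjugate) ∧
    P.adjugate = 1 - P := by
  have hXc := continuous_steeredDeriv ρ
  have hX := isHermitian_steeredDeriv hρ
  have hdet := det_steeredDeriv_neg hρ htilt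
  refine ⟨fun Y hY hYu => ⟨fun i j => ?_, ?_⟩, ?_, adjugate_eq_one_sub hP.isIdempotentElem hrank⟩
  · exact ((continuous_absRel hXc hX hdet hY hYu).matrix_elem i j).intervalIntegrable _ _
  · rw [steeringOperator_eq_integral hρ htilt hY hYu]
    exact trace_integral_absRel_ne_zero hXc hX hdet hY hYu Real.two_pi_pos
  · obtain ⟨c, hc, K, hK, hbound⟩ := exists_abs_trace_mul_steeredDeriv_le ρ P
    have hc' : c ∈ Set.Icc 0 (2 * Real.pi) := ⟨hc.1, hc.2.trans (by linarith [Real.pi_pos])⟩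
    refine (tendsto_normalized_integral_absRel hXc hX hdet Real.two_pi_pos hc' hK hbound
      hP hrank).congr' ?_
    filter_upwards [self_mem_nhdsWithin] with Y hY
    rw [steeringOperator_eq_integral hρ htilt hY.1 hY.2]

end Steering

open Steering in
theorem theorem1 (ρ : Op₂) (hρ : ρ ∈ realDensity (Fin 2 × Fin 2))
    (htilt : steeringTilt ρ < 1) (P : Op) (hP : P ∈ RP1) :
    -- the integral exists and can be normalized, for every `Y`
    (∀ Y ∈ posDefDensity (Fin 2),
      (∀ i j, IntervalIntegrable (fun θ => absRel Y (steeredDeriv ρ θ) i j)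
        MeasureTheory.volume 0 (2 * Real.pi)) ∧
      (steeringOperator ρ Y).trace ≠ 0) ∧
    -- the limit
    Filter.Tendsto (fun Y => normalized (steeringOperator ρ Y))
      (nhdsWithin P (posDefDensity (Fin 2))) (nhds P.adjugate) ∧
    P.adjugate = 1 - P := by
  obtain ⟨hintegral, hlim, hadj⟩ := theorem1_general hρ.1.1.1 htilt hP.1 hP.2.1
  have hsub := posDefDensity_subset (Fin 2)
  exact ⟨fun Y hY => hintegral Y (hsub hY).1 (hsub hY).2,
    hlim.mono_left (nhdsWithin_mono P hsub), hadj⟩
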